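/- Let $M$ be an $m$-dimensional $C^\infty$ manifold and let $T^{big}M=TM\oplus T^*M$ carry the neutral metric $g((X,\alpha),(Y,\beta))=\frac12(\alpha(Y)+\beta(X))$ and the Courant bracket $$[(X,\alpha),(Y,\beta)]=\big([X,Y],\,L_X\beta-L_Y\alpha+\tfrac12 d(\alpha(Y)-\beta(X))\big).$$ A subspace of $T^{big}_xM$ is isotropic if $g$ vanishes on it. A big-isotropic structure is a $C^\infty$ subbundle $E\subseteq T^{big}M$ of some rank $k$ with isotropic fibres $E_x$; an almost Dirac structure is a $C^\infty$ subbundle of rank $m$ whose fibres are maximal isotropic. Either is called integrable if the Courant bracket of any two of its global $C^\infty$ sections is again a section of it; an integrable almost Dirac structure is a Dirac structure. For an isotropic subspace $E_x\subseteq T_x^{big}M$ let $E'_x$ be its $g$-orthogonal space, let $\mathcal E_x\subseteq\mathcal E'_x$ be the projections of $E_x\subseteq E'_x$ to $T_xM$, and let $\varpi_x:\mathcal E_x\times\mathcal E'_x\to\mathbb R$ be the well-defined bilinear map $\varpi_x(X,Y)=\alpha(Y)$ for any $\alpha$ with $(X,\alpha)\in E_x$. Put $$D_x(E)=E_x+\mathrm{ann}\,\mathcal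 E_x,\qquad \mathrm{ann}\,\mathcal E_x=\{(0,\gamma)\,:\,\gamma|_{\mathcal E_x}=0\}.$$ (1) For every $x\in M$ and every isotropic $E_x\subseteq T^{big}_xM$, one has $E_x\subseteq D_x(E)\subseteq E'_x$, the space $D_x(E)$ is maximal isotropic, $\dim D_x(E)=m$, and $$D_x(E)=\{(X,\alpha)\,:\,X\in\mathcal E_x,\ \alpha(Y)=\varpi_x(X,Y)\ \text{for all } Y\in\mathcal E_x\}.$$ (2) Let $E$ be a big-isotropic structure on $M$ such that $D_x(E)$ is differentiable with respect to $x$, that is, for every $x_0\in M$ every vector of $D_{x_0}(E)$ is the value at $x_0$ of a local $C^\infty$ section of $T^{big}M$ with values in $D(E)=\bigcup_x D_x(E)$. Then $D(E)$ is an almost Dirac structure, and if $E$ is integrable, then $D(E)$ is a Dirac structure. -/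

import Mathlib

open Bundle Set
open scoped Manifold ContDiff

noncomputable section

namespace BigIso

/-! ### Linear algebra of `V ⊕ V*` -/

section Linear

variable (V : Type*) [AddCommGroup V] [Module ℝ V] [TopologicalSpace V]

/-- The big space `V ⊕ V*`. -/
abbrev Big : Type _ := V × (V →L[ℝ] ℝ)

/-- The neutral metric `g((X, α), (Y, β)) = (α(Y) + β(X)) / 2` on `V ⊕ V*`. -/
def metric : LinearMap.BilinForm ℝ (Big V) :=
  LinearMap.mk₂ ℝ (fun a b => (1 / 2 : ℝ) * (a.2 b.1 + b.2 a.1))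
    (by intro a b c; simp only [Prod.fst_add, Prod.snd_add, add_apply, map_add]; ring)
    (by intro r a b
        simp only [Prod.smul_fst, Prod.smul_snd, smul_apply, map_smul, smul_eq_mul]; ring)
    (by intro a b c; simp only [Prod.fst_add, Prod.snd_add, add_apply, map_add]; ring)
    (by intro r a b
        simp only [Prod.smul_fst, Prod.smul_snd, smul_apply, map_smul, smul_eq_mul]; ring)

variable {V}

/-- The `g`-orthogonal space `P' = P^{⊥_g}`. -/
def orth (P : Submodule ℝ (Big V)) : Submodule ℝ (Big V) := (metric V).orthogonal P

/-- `P` is `g`-isotropic: `g` vanishes on `P × P`. -/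
def IsIsotropic (P : Submodule ℝ (Big V)) : Prop := ∀ a ∈ P, ∀ b ∈ P, metric V a b = 0

/-- The projection of `P ⊆ V ⊕ V*` to `V`. -/
def pr (P : Submodule ℝ (Big V)) : Submodule ℝ V :=
  P.map (LinearMap.fst ℝ V (V →L[ℝ] ℝ))

/-- The annihilator of `W ⊆ V`, seen as the subspace `0 ⊕ ann W` of `V ⊕ V*`. -/
def ann (W : Submodule ℝ V) : Submodule ℝ (Big V) where
  carrier := {a | a.1 = 0 ∧ ∀ w ∈ W, a.2 w = 0}
  zero_mem' := by simp
  add_mem' := by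
    rintro a b ⟨ha, ha'⟩ ⟨hb, hb'⟩
    refine ⟨by simp [ha, hb], fun w hw => by simp [ha' w hw, hb' w hw]⟩
  smul_mem' := by
    rintro r a ⟨ha, ha'⟩
    refine ⟨by simp [ha], fun w hw => by simp [ha' w hw]⟩

theorem exists_form (P : Submodule ℝ (Big V)) (X : pr P) :
    ∃ α : V →L[ℝ] ℝ, ((X : V), α) ∈ P := by
  obtain ⟨X, ⟨⟨Y, α⟩, h, rfl⟩⟩ := X
  exact ⟨α, h⟩

/-- `α(Y)` depends only on `X` and `Y` when `(X, α) ∈ P` and `Y ∈ pr P'`. -/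
theorem form_apply_eq (P : Submodule ℝ (Big V)) {X Y : V} {α α' : V →L[ℝ] ℝ}
    (h : (X, α) ∈ P) (h' : (X, α') ∈ P) (hY : Y ∈ pr (orth P)) : α Y = α' Y := by
  obtain ⟨⟨Y, β⟩, hb, rfl⟩ := hY
  have h1 := hb _ h
  have h2 := hb _ h'
  simp only [metric, LinearMap.mk₂_apply] at h1 h2
  simp only [LinearMap.fst_apply]
  linarith

/-- The bilinear map `ϖ : pr P × pr P' → ℝ`, `ϖ(X, Y) = α(Y)` for any `α` with `(X, α) ∈ P`. -/
def varpi (P : Submodule ℝ (Big V)) : pr P →ₗ[ℝ] pr (orth P) →ₗ[ℝ] ℝ :=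
  LinearMap.mk₂ ℝ (fun X Y => (exists_form P X).choose (Y : V))
    (by
      intro X X' Y
      have h := P.add_mem (exists_form P X).choose_spec (exists_form P X').choose_spec
      exact form_apply_eq P (exists_form P (X + X')).choose_spec h Y.2)
    (by
      intro r X Y
      have h := P.smul_mem r (exists_form P X).choose_spec
      exact form_apply_eq P (exists_form P (r • X)).choose_spec h Y.2)
    (by intro X Y Y'; simp)
    (by intro r X Y; simp)

/-- The canonical extension `D(P) = P + ann (pr P)`. -/
def diracExt (P : Submodule ℝ (Big V)) : Submodule ℝ (Big V) := P ⊔ ann (pr P)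

end Linear

/-! ### The big tangent bundle of a manifold -/

section Manifold

variable {m : ℕ} {M : Type*} [TopologicalSpace M]
  [ChartedSpace (EuclideanSpace ℝ (Fin m)) M]

/-- The fibre `T_xM ⊕ T*_xM` of the big tangent bundle. -/
abbrev BigTangent (m : ℕ) {M : Type*} [TopologicalSpace M]
    [ChartedSpace (EuclideanSpace ℝ (Fin m)) M] (x : M) : Type :=
  Big (TangentSpace (𝓡 m) x)

/-- A section `x ↦ (X x, α x)` of the big tangent bundle is `C^∞` on `U`: the vector field is a
`C^∞` section of `TM` and the `1`-form is a `C^∞` section of `T*M = Hom(TM, ℝ)`. -/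
def SmoothOn [IsManifold (𝓡 m) ∞ M] (a : ∀ x : M, BigTangent m x) (U : Set M) : Prop :=
  ContMDiffOn (𝓡 m) ((𝓡 m).prod 𝓘(ℝ, EuclideanSpace ℝ (Fin m))) ∞
    (fun x => TotalSpace.mk' (EuclideanSpace ℝ (Fin m)) (E := TangentSpace (𝓡 m) (M := M))
      x (a x).1) U ∧
  ContMDiffOn (𝓡 m) ((𝓡 m).prod 𝓘(ℝ, EuclideanSpace ℝ (Fin m) →L[ℝ] ℝ)) ∞
    (fun x => TotalSpace.mk' (EuclideanSpace ℝ (Fin m) →L[ℝ] ℝ)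
      (E := fun x : M => TangentSpace (𝓡 m) x →L[ℝ] Trivial M ℝ x) x (a x).2) U

/-- The vector field `X` in the coordinates of the preferred chart at `x₀`. -/
def coordField (X : ∀ x : M, TangentSpace (𝓡 m) x) (x₀ : M) :
    EuclideanSpace ℝ (Fin m) → EuclideanSpace ℝ (Fin m) :=
  VectorField.mpullback 𝓘(ℝ, EuclideanSpace ℝ (Fin m)) (𝓡 m) (extChartAt (𝓡 m) x₀).symm X

/-- The `1`-form `β` in the coordinates of the preferred chart at `x₀`. -/
def coordForm (β : ∀ x : M, TangentSpace (𝓡 m) x →L[ℝ] ℝ) (x₀ : M) :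
    EuclideanSpace ℝ (Fin m) → (EuclideanSpace ℝ (Fin m) →L[ℝ] ℝ) := fun u =>
  (β ((extChartAt (𝓡 m) x₀).symm u)).comp
    (mfderiv 𝓘(ℝ, EuclideanSpace ℝ (Fin m)) (𝓡 m) (extChartAt (𝓡 m) x₀).symm u)

/-- The Lie derivative of a `1`-form, `(L_X β)_j = X^i ∂_i β_j + β_i ∂_j X^i`, computed at each
point `x` in the preferred chart at `x`. -/
def lieDerivForm (X : ∀ x : M, TangentSpace (𝓡 m) x)
    (β : ∀ x : M, TangentSpace (𝓡 m) x →L[ℝ] ℝ) (x : M) : TangentSpace (𝓡 m) x →L[ℝ] ℝ :=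
  (fderiv ℝ (coordForm β x) (extChartAt (𝓡 m) x x)
        (coordField X x (extChartAt (𝓡 m) x x)) +
      (coordForm β x (extChartAt (𝓡 m) x x)).comp
        (fderiv ℝ (coordField X x) (extChartAt (𝓡 m) x x))).comp
    (mfderiv (𝓡 m) 𝓘(ℝ, EuclideanSpace ℝ (Fin m)) (extChartAt (𝓡 m) x) x)

/-- The differential of a real function, as a `1`-form. -/
def dFun (f : M → ℝ) (x : M) : TangentSpace (𝓡 m) x →L[ℝ] ℝ := mfderiv (𝓡 m) 𝓘(ℝ, ℝ) f x

/-- The Courant bracket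
`[(X, α), (Y, β)] = ([X, Y], L_X β - L_Y α + (1/2) d(α(Y) - β(X)))`. -/
def courant (a b : ∀ x : M, BigTangent m x) (x : M) : BigTangent m x :=
  (VectorField.mlieBracket (𝓡 m) (fun y => (a y).1) (fun y => (b y).1) x,
    lieDerivForm (fun y => (a y).1) (fun y => (b y).2) x
      - lieDerivForm (fun y => (b y).1) (fun y => (a y).2) x
      + (1 / 2 : ℝ) • dFun (m := m) (fun y => (a y).2 (b y).1 - (b y).2 (a y).1) x)

variable [IsManifold (𝓡 m) ∞ M]

/-- A field `E` of subspaces is a `C^∞` subbundle of rank `k` of the big tangent bundle: near every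
point it has a `C^∞` frame with `k` elements. -/
def IsSubbundle (k : ℕ) (E : ∀ x : M, Submodule ℝ (BigTangent m x)) : Prop :=
  ∀ x₀ : M, ∃ U : Set M, IsOpen U ∧ x₀ ∈ U ∧ ∃ e : Fin k → ∀ x : M, BigTangent m x,
    (∀ i, SmoothOn (e i) U) ∧
    ∀ x ∈ U, LinearIndependent ℝ (fun i => e i x) ∧
      Submodule.span ℝ (range fun i => e i x) = E x

/-- A field `D` of subspaces is differentiable: every vector of every `D x₀` is the value at `x₀`
of a local `C^∞` section of `D`. -/
def IsDifferentiable (D : ∀ x : M, Submodule ℝ (BigTangent m x)) : Prop :=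
  ∀ x₀ : M, ∀ v ∈ D x₀, ∃ U : Set M, IsOpen U ∧ x₀ ∈ U ∧ ∃ s : ∀ x : M, BigTangent m x,
    SmoothOn s U ∧ (∀ x ∈ U, s x ∈ D x) ∧ s x₀ = v

/-- The global `C^∞` sections of `E`. -/
def sections (E : ∀ x : M, Submodule ℝ (BigTangent m x)) : Set (∀ x : M, BigTangent m x) :=
  {a | SmoothOn a univ ∧ ∀ x, a x ∈ E x}

/-- A big-isotropic structure of rank `k`: a `g`-isotropic subbundle of rank `k` (isotropy forces
`k ≤ m`). -/
structure IsBigIsotropic (k : ℕ) (E : ∀ x : M, Submodule ℝ (BigTangent m x)) : Prop where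
  subbundle : IsSubbundle k E
  isotropic : ∀ x, IsIsotropic (E x)

/-- `E` is integrable: the Courant bracket of two sections of `E` takes values in `E`
(brackets of `C^∞` sections are always `C^∞`). -/
def IsIntegrable (E : ∀ x : M, Submodule ℝ (BigTangent m x)) : Prop :=
  ∀ a ∈ sections E, ∀ b ∈ sections E, ∀ x, courant a b x ∈ E x

/-- An almost Dirac structure: a subbundle (of rank `m`) with maximal isotropic fibres. -/
structure IsAlmostDirac (D : ∀ x : M, Submodule ℝ (BigTangent m x)) : Prop where
  subbundle : IsSubbundle m D
  maximal : ∀ x, Maximal IsIsotropic (D x)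

/-- A Dirac structure: an integrable almost Dirac structure. -/
structure IsDirac (D : ∀ x : M, Submodule ℝ (BigTangent m x)) : Prop where
  almostDirac : IsAlmostDirac D
  integrable : IsIntegrable D

end Manifold

end BigIso

end

open Bundle Set
open scoped Manifold ContDiff

noncomputable section

namespace BigIso

/-! ### Linear algebra of a single fibre `V ⊕ V*`. -/

section LinearAlgebra

variable {V : Type*} [AddCommGroup V] [Module ℝ V] [TopologicalSpace V]

/-! In one fibre, `D = P + ann (pr P)` equals its own orthogonal space: orthogonality to `ann (pr
P)` forces the vector part into `pr P`, and orthogonality to `P` then fixes the covector on `pr P`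
(`orth_diracExt_le`). As `g` is nondegenerate, this gives maximality and `dim D = m`.

On a manifold, a differentiable field of subspaces of constant dimension has local frames, so `D(E)`
is a subbundle. For integrability, `D = D^⊥` reduces the claim to `g([a, b], c) = 0` for sections
`a`, `b`, `c` of `D(E)`. A Cartan formula turns `2 g([a, b], c)` into `courantForm`, built from Lie
brackets of vector fields and differentials of functions, hence additive in each slot and continuous
on `M`.

By continuity it suffices to work on the dense set where the rank of `pr E` is locally constant
(`dense_regular`). There a section of `D(E)` splits near the point as a section of `E` plus a
section with zero vector part (`exists_section_fst_eq`). The terms with both of `a`, `b` from `E`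
vanish by integrability of `E`; those with neither vanish identically; a mixed term reduces to an
annihilator of `pr E` evaluated on a Lie bracket of vector parts of sections of `E`, which lies in
`pr E` because `E` is integrable. -/

theorem metric_apply (a b : Big V) : metric V a b = (1 / 2 : ℝ) * (a.2 b.1 + b.2 a.1) := rfl

theorem metric_comm (a b : Big V) : metric V a b = metric V b a := by
  simp only [metric_apply]; ring

theorem metric_isRefl : (metric V).IsRefl := fun a b h => by rwa [metric_comm]

theorem mem_pr {P : Submodule ℝ (Big V)} {X : V} :
    X ∈ pr P ↔ ∃ α : V →L[ℝ] ℝ, (X, α) ∈ P :=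
  ⟨fun h => exists_form P ⟨X, h⟩, fun ⟨α, h⟩ => ⟨(X, α), h, rfl⟩⟩

theorem fst_mem_pr {P : Submodule ℝ (Big V)} {a : Big V} (ha : a ∈ P) : a.1 ∈ pr P :=
  mem_pr.2 ⟨a.2, ha⟩

theorem IsIsotropic.add_eq_zero {P : Submodule ℝ (Big V)} (hP : IsIsotropic P) {a b : Big V}
    (ha : a ∈ P) (hb : b ∈ P) : a.2 b.1 + b.2 a.1 = 0 := by
  have := hP a ha b hb
  rw [metric_apply] at this
  linarith

theorem IsIsotropic.le_orth {P : Submodule ℝ (Big V)} (hP : IsIsotropic P) : P ≤ orth P :=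
  fun b hb a ha => hP a ha b hb

theorem pr_mono {P Q : Submodule ℝ (Big V)} (h : P ≤ Q) : pr P ≤ pr Q := Submodule.map_mono h

/-- Adding an annihilator changes a covector freely off `pr P` and not at all on it. This form
replaces the sum in the pairing computations below. -/
theorem mem_diracExt {P : Submodule ℝ (Big V)} {X : V} {α : V →L[ℝ] ℝ} :
    (X, α) ∈ diracExt P ↔ ∃ α₀ : V →L[ℝ] ℝ, (X, α₀) ∈ P ∧ ∀ w ∈ pr P, α w = α₀ w := by
  rw [diracExt, Submodule.mem_sup]
  constructor
  · rintro ⟨⟨Y, β⟩, hy, ⟨Z, γ⟩, ⟨rfl, hz⟩, h⟩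
    simp only [Prod.mk_add_mk, add_zero, Prod.mk.injEq] at h
    obtain ⟨rfl, rfl⟩ := h
    exact ⟨β, hy, fun w hw => by simpa using hz w hw⟩
  · rintro ⟨α₀, h, hw⟩
    exact ⟨_, h, (0, α) - (0, α₀), ⟨by simp, fun w h' => by simp [hw w h']⟩, by simp⟩

theorem pr_diracExt (P : Submodule ℝ (Big V)) : pr (diracExt P) = pr P := by
  refine le_antisymm (fun X hX => ?_) (pr_mono le_sup_left)
  obtain ⟨α, h⟩ := mem_pr.1 hX
  obtain ⟨α₀, h, -⟩ := mem_diracExt.1 h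
  exact fst_mem_pr h

theorem IsIsotropic.diracExt {P : Submodule ℝ (Big V)} (hP : IsIsotropic P) :
    IsIsotropic (diracExt P) := by
  rintro ⟨X, α⟩ ha ⟨Y, β⟩ hb
  obtain ⟨α₀, ha, hα⟩ := mem_diracExt.1 ha
  obtain ⟨β₀, hb, hβ⟩ := mem_diracExt.1 hb
  rw [metric_apply, hα _ (fst_mem_pr hb), hβ _ (fst_mem_pr ha)]
  simpa using hP.add_eq_zero ha hb

theorem IsIsotropic.mem_diracExt_iff {P : Submodule ℝ (Big V)} (hP : IsIsotropic P)
    {X : V} {α : V →L[ℝ] ℝ} :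
    (X, α) ∈ BigIso.diracExt P ↔ ∃ hX : X ∈ pr P, ∀ (Y : V) (hY : Y ∈ pr (orth P)),
      Y ∈ pr P → α Y = varpi P ⟨X, hX⟩ ⟨Y, hY⟩ := by
  -- The covector chosen in the definition of `varpi` may be replaced by any other one over `X`.
  have key (hX : X ∈ pr P) {α₀ : V →L[ℝ] ℝ} (h₀ : (X, α₀) ∈ P) (Y : V) (hY : Y ∈ pr (orth P)) :
      varpi P ⟨X, hX⟩ ⟨Y, hY⟩ = α₀ Y :=
    form_apply_eq P (exists_form P ⟨X, hX⟩).choose_spec h₀ hY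
  rw [mem_diracExt]
  constructor
  · rintro ⟨α₀, h₀, h⟩
    exact ⟨fst_mem_pr h₀, fun Y hY hY' => by rw [key _ h₀, h Y hY']⟩
  · rintro ⟨hX, h⟩
    obtain ⟨α₀, h₀⟩ := mem_pr.1 hX
    exact ⟨α₀, h₀, fun Y hY => by rw [h Y (pr_mono hP.le_orth hY) hY, key hX h₀]⟩

variable [IsTopologicalAddGroup V] [ContinuousSMul ℝ V] [T2Space V] [FiniteDimensional ℝ V]

theorem exists_clm_of_notMem {W : Submodule ℝ V} {X : V} (hX : X ∉ W) :
    ∃ γ : V →L[ℝ] ℝ, γ X ≠ 0 ∧ ∀ w ∈ W, γ w = 0 := by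
  obtain ⟨f, hf, hW⟩ := Submodule.exists_le_ker_of_notMem hX
  exact ⟨LinearMap.toContinuousLinearMap f, hf, fun w hw => hW hw⟩

/-- A vector outside `pr P` is detected by some functional vanishing on `pr P`; once `X ∈ pr P`,
pairing with `P` compares `α` with a covector `α₀` already over `X`. -/
theorem orth_diracExt_le {P : Submodule ℝ (Big V)} (hP : IsIsotropic P) :
    orth (diracExt P) ≤ diracExt P := by
  rintro ⟨X, α⟩ h
  have hX : X ∈ pr P := by
    by_contra hX
    obtain ⟨γ, hγ, hW⟩ := exists_clm_of_notMem hX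
    have := h (0, γ) (Submodule.mem_sup_right ⟨rfl, hW⟩)
    simp [metric_apply, hγ] at this
  obtain ⟨α₀, h₀⟩ := mem_pr.1 hX
  refine mem_diracExt.2 ⟨α₀, h₀, fun Y hY => ?_⟩
  obtain ⟨β, hβ⟩ := mem_pr.1 hY
  have h1 := h (Y, β) (Submodule.mem_sup_left hβ)
  have h2 := hP.add_eq_zero hβ h₀
  simp only [metric_apply] at h1 h2
  linarith

theorem orth_diracExt {P : Submodule ℝ (Big V)} (hP : IsIsotropic P) :
    orth (diracExt P) = diracExt P :=
  le_antisymm (orth_diracExt_le hP) hP.diracExt.le_orth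

theorem maximal_diracExt {P : Submodule ℝ (Big V)} (hP : IsIsotropic P) :
    Maximal IsIsotropic (diracExt P) :=
  ⟨hP.diracExt, fun _ hQ hle b hb =>
    orth_diracExt_le hP fun a ha => hQ a (hle ha) b hb⟩

variable (V) in
theorem metric_nondegenerate : (metric V).Nondegenerate := by
  refine LinearMap.IsRefl.nondegenerate_iff_separatingLeft (B := metric V) (fun a b h => metric_isRefl a b h) |>.2 ?_
  rintro ⟨X, α⟩ h
  have hα : α = 0 := by
    ext Y
    simpa [metric_apply] using h (Y, 0)
  have hX : X = 0 := by
    by_contra hX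
    obtain ⟨γ, hγ, -⟩ := exists_clm_of_notMem (W := ⊥) (X := X) (by simpa using hX)
    have := h (0, γ)
    simp [metric_apply, hγ] at this
  simp [hα, hX]

instance finiteDimensional_clm : FiniteDimensional ℝ (V →L[ℝ] ℝ) :=
  Module.Finite.equiv (LinearMap.toContinuousLinearMap (𝕜 := ℝ) (E := V) (F' := ℝ))

theorem finrank_big : Module.finrank ℝ (Big V) = 2 * Module.finrank ℝ V := by
  have h : Module.finrank ℝ (V →L[ℝ] ℝ) = Module.finrank ℝ V := by
    rw [← (LinearMap.toContinuousLinearMap (𝕜 := ℝ) (E := V) (F' := ℝ)).finrank_eq]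
    exact Subspace.dual_finrank_eq
  rw [Module.finrank_prod, h, two_mul]

/-- Nondegeneracy makes `dim D` and `dim D^⊥` add up to `2 dim V`, and `D = D^⊥`. -/
theorem finrank_diracExt {P : Submodule ℝ (Big V)} (hP : IsIsotropic P) :
    Module.finrank ℝ (diracExt P) = Module.finrank ℝ V := by
  have h := LinearMap.BilinForm.finrank_orthogonal (metric_nondegenerate V) (diracExt P)
  have h' : (metric V).orthogonal (diracExt P) = diracExt P := orth_diracExt hP
  have hle := Submodule.finrank_le (diracExt P)
  rw [h'] at h
  rw [finrank_big] at h hle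
  omega

end LinearAlgebra

/-! ### Smooth sections and their extension from local to global. -/

section Sections

variable {m : ℕ} {M : Type*} [TopologicalSpace M] [ChartedSpace (EuclideanSpace ℝ (Fin m)) M]

instance finiteDimensional_tangentSpace (x : M) : FiniteDimensional ℝ (TangentSpace (𝓡 m) x) :=
  inferInstanceAs (FiniteDimensional ℝ (EuclideanSpace ℝ (Fin m)))

instance t2Space_tangentSpace (x : M) : T2Space (TangentSpace (𝓡 m) x) :=
  inferInstanceAs (T2Space (EuclideanSpace ℝ (Fin m)))

theorem finrank_tangentSpace (x : M) : Module.finrank ℝ (TangentSpace (𝓡 m) x) = m :=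
  finrank_euclideanSpace_fin (𝕜 := ℝ)

variable [IsManifold (𝓡 m) ∞ M] {a b : ∀ x : M, BigTangent m x} {f : M → ℝ} {U W : Set M}

theorem SmoothOn.mono (ha : SmoothOn a U) (h : W ⊆ U) : SmoothOn a W :=
  ⟨ha.1.mono h, ha.2.mono h⟩

theorem SmoothOn.add (ha : SmoothOn a U) (hb : SmoothOn b U) : SmoothOn (a + b) U :=
  ⟨ha.1.add_section hb.1, ha.2.add_section hb.2⟩

theorem SmoothOn.sub (ha : SmoothOn a U) (hb : SmoothOn b U) : SmoothOn (a - b) U :=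
  ⟨ha.1.sub_section hb.1, ha.2.sub_section hb.2⟩

theorem SmoothOn.smul (hf : ContMDiffOn (𝓡 m) 𝓘(ℝ, ℝ) ∞ f U) (ha : SmoothOn a U) :
    SmoothOn (fun x => f x • a x) U :=
  ⟨hf.smul_section ha.1, hf.smul_section ha.2⟩

theorem SmoothOn.sum {ι : Type*} {s : Finset ι} {t : ι → ∀ x : M, BigTangent m x}
    (h : ∀ i ∈ s, SmoothOn (t i) U) : SmoothOn (fun x => ∑ i ∈ s, t i x) U := by
  simp only [SmoothOn, Prod.fst_sum, Prod.snd_sum]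
  exact ⟨.sum_section fun i hi => (h i hi).1, .sum_section fun i hi => (h i hi).2⟩

theorem SmoothOn.smul_of_tsupport (hf : ContMDiffOn (𝓡 m) 𝓘(ℝ, ℝ) ∞ f U) (hU : IsOpen U)
    (hfU : tsupport f ⊆ U) (ha : SmoothOn a U) : SmoothOn (fun x => f x • a x) univ :=
  ⟨(ContMDiffOn.smul_section_of_tsupport hf hU hfU ha.1).contMDiffOn,
    (ContMDiffOn.smul_section_of_tsupport hf hU hfU ha.2).contMDiffOn⟩

theorem SmoothOn.pairing (ha : SmoothOn a U) (hb : SmoothOn b U) :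
    ContMDiffOn (𝓡 m) 𝓘(ℝ, ℝ) ∞ (fun x => (a x).2 (b x).1) U := by
  have := ContMDiffOn.clm_bundle_apply ha.2 hb.1
  intro x hx
  exact contMDiffWithinAt_section.1 (this x hx)

theorem SmoothOn.metric (ha : SmoothOn a U) (hb : SmoothOn b U) :
    ContMDiffOn (𝓡 m) 𝓘(ℝ, ℝ) ∞ (fun x => BigIso.metric (TangentSpace (𝓡 m) x) (a x) (b x)) U :=
  contMDiffOn_const.mul ((ha.pairing hb).add (hb.pairing ha))

variable [T2Space M]

/-- Multiplication by a bump function. It equals `1` on a neighbourhood, not only at `x₀`, so the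
germ is kept and derivatives at `x₀` are unaffected. -/
theorem SmoothOn.exists_global {s : ∀ x : M, BigTangent m x} (hU : IsOpen U) {x₀ : M}
    (hx₀ : x₀ ∈ U) (hs : SmoothOn s U) :
    ∃ f : M → ℝ, (∀ᶠ x in nhds x₀, f x = 1) ∧ (∀ x ∉ U, f x = 0) ∧
      SmoothOn (fun x => f x • s x) univ := by
  obtain ⟨φ, -, hφ⟩ := ((SmoothBumpFunction.nhds_basis_tsupport (I := 𝓡 m) x₀).mem_iff).1
    (hU.mem_nhds hx₀)
  exact ⟨φ, φ.eventuallyEq_one, fun x hx => image_eq_zero_of_notMem_tsupport fun h => hx (hφ h),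
    hs.smul_of_tsupport φ.contMDiff.contMDiffOn hU hφ⟩

theorem IsDifferentiable.exists_section {D : ∀ x : M, Submodule ℝ (BigTangent m x)}
    (hD : IsDifferentiable D) {x₀ : M} {v : BigTangent m x₀} (hv : v ∈ D x₀) :
    ∃ s ∈ sections D, s x₀ = v := by
  obtain ⟨U, hU, hx₀, s, hs, hsD, rfl⟩ := hD x₀ v hv
  obtain ⟨f, hf1, hf0, hf⟩ := hs.exists_global hU hx₀
  refine ⟨_, ⟨hf, fun x => ?_⟩, by simp [hf1.self_of_nhds]⟩
  by_cases hx : x ∈ U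
  · exact (D x).smul_mem _ (hsD x hx)
  · simp [hf0 x hx]

omit [T2Space M] in
theorem isDifferentiable_top : IsDifferentiable fun x : M => (⊤ : Submodule ℝ (BigTangent m x)) := by
  intro x₀ v _
  obtain ⟨S, hS, h1⟩ := FiberBundle.exists_contMDiffOn_extend (I := 𝓡 m) (k := ∞)
    (F := EuclideanSpace ℝ (Fin m)) v.1
  obtain ⟨S', hS', h2⟩ := FiberBundle.exists_contMDiffOn_extend (I := 𝓡 m) (k := ∞)
    (F := EuclideanSpace ℝ (Fin m) →L[ℝ] ℝ)
    (V := fun x : M => TangentSpace (𝓡 m) x →L[ℝ] Trivial M ℝ x) (x₀ := x₀) v.2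
  refine ⟨interior (S ∩ S'), isOpen_interior, mem_interior_iff_mem_nhds.2 (Filter.inter_mem hS hS'),
    fun x => (FiberBundle.extend _ v.1 x, FiberBundle.extend (EuclideanSpace ℝ (Fin m) →L[ℝ] ℝ)
      (E := fun x : M => TangentSpace (𝓡 m) x →L[ℝ] Trivial M ℝ x) v.2 x),
    ⟨h1.mono (interior_subset.trans inter_subset_left),
      h2.mono (interior_subset.trans inter_subset_right)⟩, fun _ _ => trivial, ?_⟩
  ext1
  · exact FiberBundle.extend_apply_self ..
  · exact FiberBundle.extend_apply_self
      (E := fun x : M => TangentSpace (𝓡 m) x →L[ℝ] Trivial M ℝ x) ..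

/-- Supplies the test sections whose pairings detect linear independence. -/
theorem exists_smooth_section {x₀ : M} (v : BigTangent m x₀) :
    ∃ s : ∀ x : M, BigTangent m x, SmoothOn s univ ∧ s x₀ = v := by
  obtain ⟨s, hs, h⟩ := isDifferentiable_top.exists_section (v := v) trivial
  exact ⟨s, hs.1, h⟩

omit [T2Space M] in
theorem IsSubbundle.isDifferentiable {k : ℕ} {E : ∀ x : M, Submodule ℝ (BigTangent m x)}
    (hE : IsSubbundle k E) : IsDifferentiable E := by
  intro x₀ v hv
  obtain ⟨U, hU, hx₀, e, he, h⟩ := hE x₀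
  rw [← (h x₀ hx₀).2, Submodule.mem_span_range_iff_exists_fun] at hv
  obtain ⟨c, rfl⟩ := hv
  refine ⟨U, hU, hx₀, fun x => ∑ i, c i • e i x, .sum fun i _ => .smul contMDiffOn_const (he i),
    fun x hx => ?_, rfl⟩
  rw [← (h x hx).2]
  exact Submodule.sum_mem _ fun i _ =>
    Submodule.smul_mem _ _ (Submodule.subset_span (mem_range_self i))

end Sections

/-! ### The Lie derivative of a form, computed in a chart. -/

section LieDerivative

variable {m : ℕ} {M : Type*} [TopologicalSpace M] [ChartedSpace (EuclideanSpace ℝ (Fin m)) M]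

theorem mfderiv_extChartAt_symm_eq (x : M) (u : EuclideanSpace ℝ (Fin m)) :
    mfderiv 𝓘(ℝ, EuclideanSpace ℝ (Fin m)) (𝓡 m) (extChartAt (𝓡 m) x).symm u =
      mfderivWithin 𝓘(ℝ, EuclideanSpace ℝ (Fin m)) (𝓡 m) (extChartAt (𝓡 m) x).symm
        (range (𝓡 m)) u := by
  rw [ModelWithCorners.range_eq_univ, mfderivWithin_univ]

theorem mfderiv_eq_coord {f : M → ℝ} {x : M} (hf : MDifferentiableAt (𝓡 m) 𝓘(ℝ, ℝ) f x) :
    mfderiv (𝓡 m) 𝓘(ℝ, ℝ) f x =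
      fderiv ℝ (fun u => f ((extChartAt (𝓡 m) x).symm u)) (extChartAt (𝓡 m) x x) := by
  rw [hf.mfderiv, ModelWithCorners.range_eq_univ, fderivWithin_univ]
  rfl

variable [IsManifold (𝓡 m) ∞ M]

/-- The tangent space at `x` is identified with the model space through the preferred chart at `x`,
so at the base point coordinate expressions agree with the fields themselves. -/
theorem mfderiv_extChartAt_symm_self (x : M) :
    mfderiv 𝓘(ℝ, EuclideanSpace ℝ (Fin m)) (𝓡 m) (extChartAt (𝓡 m) x).symm
      (extChartAt (𝓡 m) x x) = ContinuousLinearMap.id ℝ (EuclideanSpace ℝ (Fin m)) := by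
  rw [mfderiv_extChartAt_symm_eq]
  exact mfderivWithin_range_extChartAt_symm

theorem coordForm_self (β : ∀ x : M, TangentSpace (𝓡 m) x →L[ℝ] ℝ) (x : M)
    (v : EuclideanSpace ℝ (Fin m)) :
    coordForm β x (extChartAt (𝓡 m) x x) v = β x v := by
  have h : coordForm β x (extChartAt (𝓡 m) x x) v =
      β ((extChartAt (𝓡 m) x).symm (extChartAt (𝓡 m) x x))
        (mfderiv 𝓘(ℝ, EuclideanSpace ℝ (Fin m)) (𝓡 m) (extChartAt (𝓡 m) x).symm
          (extChartAt (𝓡 m) x x) v) := rfl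
  rw [h, mfderiv_extChartAt_symm_self, extChartAt_to_inv]
  rfl

theorem coordField_self (X : ∀ x : M, TangentSpace (𝓡 m) x) (x : M) :
    coordField X x (extChartAt (𝓡 m) x x) = X x := by
  have h : coordField X x (extChartAt (𝓡 m) x x) =
      (mfderiv 𝓘(ℝ, EuclideanSpace ℝ (Fin m)) (𝓡 m) (extChartAt (𝓡 m) x).symm
          (extChartAt (𝓡 m) x x)).inverse
        (X ((extChartAt (𝓡 m) x).symm (extChartAt (𝓡 m) x x))) := rfl
  rw [h, mfderiv_extChartAt_symm_eq, extChartAt_to_inv]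
  exact mfderivWithin_extChartAt_symm_inverse_apply _

theorem coordForm_coordField (β : ∀ x : M, TangentSpace (𝓡 m) x →L[ℝ] ℝ)
    (X : ∀ x : M, TangentSpace (𝓡 m) x) (x : M) {u : EuclideanSpace ℝ (Fin m)}
    (hu : u ∈ (extChartAt (𝓡 m) x).target) :
    coordForm β x u (coordField X x u) =
      β ((extChartAt (𝓡 m) x).symm u) (X ((extChartAt (𝓡 m) x).symm u)) := by
  have h := (isInvertible_mfderivWithin_extChartAt_symm (I := 𝓡 m) hu).self_comp_inverse
  rw [← mfderiv_extChartAt_symm_eq] at h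
  exact congrArg _ (DFunLike.congr_fun h _)

theorem differentiableAt_coordField {X : ∀ x : M, TangentSpace (𝓡 m) x} {x : M}
    (hX : MDifferentiableAt (𝓡 m) ((𝓡 m).prod 𝓘(ℝ, EuclideanSpace ℝ (Fin m)))
      (fun y => TotalSpace.mk' (EuclideanSpace ℝ (Fin m)) (E := TangentSpace (𝓡 m) (M := M))
        y (X y)) x) :
    DifferentiableAt ℝ (coordField X x) (extChartAt (𝓡 m) x x) := by
  have h := (hX.mdifferentiableWithinAt (s := univ)).differentiableWithinAt_mpullbackWithin_vectorField
  rw [ModelWithCorners.range_eq_univ, VectorField.mpullbackWithin_univ, preimage_univ,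
    univ_inter] at h
  have h' : DifferentiableWithinAt ℝ (coordField X x) univ (extChartAt (𝓡 m) x x) := h
  exact differentiableWithinAt_univ.1 h'

theorem mlieBracket_eq_coord (X Z : ∀ x : M, TangentSpace (𝓡 m) x) (x : M) :
    VectorField.mlieBracket (𝓡 m) X Z x =
      VectorField.lieBracket ℝ (coordField X x) (coordField Z x) (extChartAt (𝓡 m) x x) := by
  rw [← VectorField.mlieBracketWithin_univ, VectorField.mlieBracketWithin_apply,
    mfderiv_extChartAt_self, ModelWithCorners.range_eq_univ, VectorField.mpullbackWithin_univ,
    VectorField.mpullbackWithin_univ, preimage_univ, univ_inter]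
  have h (v : EuclideanSpace ℝ (Fin m)) :
      (ContinuousLinearMap.id ℝ (EuclideanSpace ℝ (Fin m))).inverse v = v := by
    rw [ContinuousLinearMap.inverse_id]; rfl
  refine (h _).trans ?_
  rw [← VectorField.lieBracketWithin_univ]
  rfl

/-- The vector field on the domain of the chart at `x` with constant coordinates `v`. -/
def constField (x : M) (v : EuclideanSpace ℝ (Fin m)) : ∀ y : M, TangentSpace (𝓡 m) y :=
  VectorField.mpullback (𝓡 m) 𝓘(ℝ, EuclideanSpace ℝ (Fin m)) (extChartAt (𝓡 m) x) fun _ => v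

theorem contMDiffOn_constField (x : M) (v : EuclideanSpace ℝ (Fin m)) :
    ContMDiffOn (𝓡 m) ((𝓡 m).prod 𝓘(ℝ, EuclideanSpace ℝ (Fin m))) ∞
      (fun y => TotalSpace.mk' (EuclideanSpace ℝ (Fin m)) (E := TangentSpace (𝓡 m) (M := M))
        y (constField x v y)) (extChartAt (𝓡 m) x).source := by
  intro y hy
  refine (ContMDiffAt.mpullback_vectorField_preimage (n := ∞) ?_
    (contMDiffAt_extChartAt' (by simpa using hy)) (isInvertible_mfderiv_extChartAt hy)
    (by rfl)).contMDiffWithinAt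
  exact contMDiffAt_vectorSpace_iff_contDiffAt.2 contDiffAt_const

theorem mfderiv_symm_eq_constField (x : M) (v : EuclideanSpace ℝ (Fin m))
    {u : EuclideanSpace ℝ (Fin m)} (hu : u ∈ (extChartAt (𝓡 m) x).target) :
    mfderiv 𝓘(ℝ, EuclideanSpace ℝ (Fin m)) (𝓡 m) (extChartAt (𝓡 m) x).symm u v =
      constField x v ((extChartAt (𝓡 m) x).symm u) := by
  have h := mfderiv_extChartAt_comp_mfderivWithin_extChartAt_symm (I := 𝓡 m) hu
  rw [← mfderiv_extChartAt_symm_eq] at h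
  have hi := isInvertible_mfderiv_extChartAt (I := 𝓡 m) ((extChartAt (𝓡 m) x).map_target hu)
  have h' := DFunLike.congr_fun h v
  symm
  exact hi.inverse_apply_eq.2 h'.symm

/-- Each component of the coordinate form is `β` paired with a smooth field of constant coordinates,
and in finite dimension smoothness can be checked on components. -/
theorem differentiableAt_coordForm {β : ∀ x : M, TangentSpace (𝓡 m) x →L[ℝ] ℝ} {x : M}
    (hβ : ContMDiff (𝓡 m) ((𝓡 m).prod 𝓘(ℝ, EuclideanSpace ℝ (Fin m) →L[ℝ] ℝ)) ∞
      (fun y => TotalSpace.mk' (EuclideanSpace ℝ (Fin m) →L[ℝ] ℝ)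
        (E := fun y : M => TangentSpace (𝓡 m) y →L[ℝ] Trivial M ℝ y) y (β y))) :
    DifferentiableAt ℝ (coordForm β x) (extChartAt (𝓡 m) x x) := by
  have h : ContDiffOn ℝ ∞ (coordForm β x) (extChartAt (𝓡 m) x).target := by
    rw [contDiffOn_clm_apply]
    intro v
    have h1 := hβ.contMDiffOn.clm_bundle_apply (contMDiffOn_constField x v)
    have h2 : ContMDiffOn (𝓡 m) 𝓘(ℝ, ℝ) ∞ (fun y => β y (constField x v y))
        (extChartAt (𝓡 m) x).source := fun y hy => contMDiffWithinAt_section.1 (h1 y hy)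
    have h3 := h2.comp (contMDiffOn_extChartAt_symm x) fun u hu => (extChartAt (𝓡 m) x).map_target hu
    refine (contMDiffOn_iff_contDiffOn.1 h3).congr fun u hu => ?_
    exact congrArg (β _) (mfderiv_symm_eq_constField x v hu)
  exact (h.contDiffAt (extChartAt_target_mem_nhds x)).differentiableAt (by simp)

/-- The Cartan-type formula `(L_X β)(Z) = X(β(Z)) - β([X, Z])`. -/
theorem lieDerivForm_apply {X Z : ∀ x : M, TangentSpace (𝓡 m) x}
    {β : ∀ x : M, TangentSpace (𝓡 m) x →L[ℝ] ℝ} {x : M}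
    (hZ : ContMDiff (𝓡 m) ((𝓡 m).prod 𝓘(ℝ, EuclideanSpace ℝ (Fin m))) ∞
      (fun y => TotalSpace.mk' (EuclideanSpace ℝ (Fin m)) (E := TangentSpace (𝓡 m) (M := M))
        y (Z y)))
    (hβ : ContMDiff (𝓡 m) ((𝓡 m).prod 𝓘(ℝ, EuclideanSpace ℝ (Fin m) →L[ℝ] ℝ)) ∞
      (fun y => TotalSpace.mk' (EuclideanSpace ℝ (Fin m) →L[ℝ] ℝ)
        (E := fun y : M => TangentSpace (𝓡 m) y →L[ℝ] Trivial M ℝ y) y (β y))) :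
    lieDerivForm X β x (Z x) = dFun (m := m) (fun y => β y (Z y)) x (X x) -
      β x (VectorField.mlieBracket (𝓡 m) X Z x) := by
  set p := extChartAt (𝓡 m) x x with hp
  have hf : ContMDiff (𝓡 m) 𝓘(ℝ, ℝ) ∞ (fun y => β y (Z y)) := fun y =>
    contMDiffAt_section _ |>.1 ((hβ.clm_bundle_apply hZ) y)
  have hB := differentiableAt_coordForm (x := x) hβ
  have hV := differentiableAt_coordField ((hZ x).mdifferentiableAt (by simp))
  have h1 : dFun (m := m) (fun y => β y (Z y)) x =
      fderiv ℝ (fun u => coordForm β x u (coordField Z x u)) p := by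
    rw [dFun, mfderiv_eq_coord ((hf x).mdifferentiableAt (by simp))]
    refine Filter.EventuallyEq.fderiv_eq ?_
    filter_upwards [extChartAt_target_mem_nhds (I := 𝓡 m) x] with u hu
    exact (coordForm_coordField β Z x hu).symm
  have h2 : lieDerivForm X β x (Z x) = fderiv ℝ (coordForm β x) p (coordField X x p) (Z x) +
      coordForm β x p (fderiv ℝ (coordField X x) p (Z x)) := by
    unfold lieDerivForm
    rw [mfderiv_extChartAt_self]
    rfl
  have h3 (v : EuclideanSpace ℝ (Fin m)) :
      fderiv ℝ (fun u => coordForm β x u (coordField Z x u)) p v =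
        coordForm β x p (fderiv ℝ (coordField Z x) p v) +
          fderiv ℝ (coordForm β x) p v (coordField Z x p) := by
    rw [fderiv_clm_apply hB hV]; rfl
  -- In coordinates `[X, Z] = DZ(X) - DX(Z)`: the `DZ(X)` term from the product rule cancels,
  -- leaving the two terms of `lieDerivForm`.
  rw [h1, h2, mlieBracket_eq_coord, ← coordForm_self, VectorField.lieBracket, map_sub]
  refine Eq.trans ?_ (congrArg (· - _) (h3 (X x)).symm)
  rw [← hp, coordField_self, coordField_self]
  abel

end LieDerivative

/-! ### The form `2 g([a, b], c)`: vanishing, additivity, continuity. -/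

section CourantForm

variable {m : ℕ} {M : Type*} [TopologicalSpace M] [ChartedSpace (EuclideanSpace ℝ (Fin m)) M]

theorem dFun_eq_zero {f : M → ℝ} {x : M} (hf : f =ᶠ[nhds x] fun _ => 0) :
    dFun (m := m) f x = 0 := by
  rw [dFun, hf.mfderiv_eq]
  exact mfderiv_const

theorem dFun_add {f g : M → ℝ} {x : M} (hf : MDifferentiableAt (𝓡 m) 𝓘(ℝ, ℝ) f x)
    (hg : MDifferentiableAt (𝓡 m) 𝓘(ℝ, ℝ) g x) :
    dFun (m := m) (fun y => f y + g y) x = dFun f x + dFun g x :=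
  mfderiv_add hf hg

theorem dFun_neg (f : M → ℝ) (x : M) :
    dFun (m := m) (fun y => -f y) x = -dFun f x :=
  mfderiv_neg

theorem mlieBracket_eq_zero_left {X Y : ∀ x : M, TangentSpace (𝓡 m) x} {x : M}
    (hX : ∀ᶠ y in nhds x, X y = 0) : VectorField.mlieBracket (𝓡 m) X Y x = 0 := by
  have h : X =ᶠ[nhds x] (0 : ∀ y : M, TangentSpace (𝓡 m) y) := hX
  exact (h.mlieBracket_vectorField_eq (Filter.EventuallyEq.refl _ Y)).trans
    (congrFun (VectorField.mlieBracket_zero_left (I := 𝓡 m) (W := Y)) x)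

theorem mlieBracket_eq_zero_right {X Y : ∀ x : M, TangentSpace (𝓡 m) x} {x : M}
    (hY : ∀ᶠ y in nhds x, Y y = 0) : VectorField.mlieBracket (𝓡 m) X Y x = 0 := by
  rw [VectorField.mlieBracket_swap_apply, mlieBracket_eq_zero_left hY, neg_zero]

/-- The function `2 g([a, b], c)` in terms of Lie brackets of vector fields and derivatives of
functions. -/
def courantForm (a b c : ∀ x : M, BigTangent m x) (x : M) : ℝ :=
  (dFun (m := m) (fun y => (b y).2 (c y).1) x (a x).1 -
      (b x).2 (VectorField.mlieBracket (𝓡 m) (fun y => (a y).1) (fun y => (c y).1) x)) -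
    (dFun (m := m) (fun y => (a y).2 (c y).1) x (b x).1 -
      (a x).2 (VectorField.mlieBracket (𝓡 m) (fun y => (b y).1) (fun y => (c y).1) x)) +
    (1 / 2 : ℝ) * dFun (m := m) (fun y => (a y).2 (b y).1 - (b y).2 (a y).1) x (c x).1 +
    (c x).2 (VectorField.mlieBracket (𝓡 m) (fun y => (a y).1) (fun y => (b y).1) x)

theorem courantForm_swap (a b c : ∀ x : M, BigTangent m x) (x : M) :
    courantForm b a c x = -courantForm a b c x := by
  have h : (fun y => (b y).2 (a y).1 - (a y).2 (b y).1) =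
      fun y => -((a y).2 (b y).1 - (b y).2 (a y).1) := by ext; ring
  simp only [courantForm, h, dFun_neg]
  rw [VectorField.mlieBracket_swap_apply (V := fun y => (b y).1) (W := fun y => (a y).1),
    map_neg, neg_apply]
  ring

/-- Vanishing is required near `x`, not just at `x`, because brackets and differentials see first
derivatives; the same holds in the next two lemmas. -/
theorem courantForm_eq_zero_of_fst_fst {a b : ∀ x : M, BigTangent m x} {x : M}
    (ha : ∀ᶠ y in nhds x, (a y).1 = 0) (hb : ∀ᶠ y in nhds x, (b y).1 = 0)
    (c : ∀ x : M, BigTangent m x) : courantForm a b c x = 0 := by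
  have h : (fun y => (a y).2 (b y).1 - (b y).2 (a y).1) =ᶠ[nhds x] fun _ => 0 := by
    filter_upwards [ha, hb] with y h1 h2
    simp [h1, h2]
  rw [courantForm, dFun_eq_zero h, mlieBracket_eq_zero_left ha, mlieBracket_eq_zero_left ha,
    mlieBracket_eq_zero_left hb, ha.self_of_nhds, hb.self_of_nhds]
  simp

theorem courantForm_eq_zero_of_fst_snd (a : ∀ x : M, BigTangent m x)
    {b c : ∀ x : M, BigTangent m x} {x : M}
    (hb : ∀ᶠ y in nhds x, (b y).1 = 0) (hc : ∀ᶠ y in nhds x, (c y).1 = 0) :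
    courantForm a b c x = 0 := by
  have h : (fun y => (b y).2 (c y).1) =ᶠ[nhds x] fun _ => 0 := by
    filter_upwards [hc] with y h2
    simp [h2]
  rw [courantForm, dFun_eq_zero h, mlieBracket_eq_zero_right hc, mlieBracket_eq_zero_right hc,
    mlieBracket_eq_zero_right hb, hb.self_of_nhds, hc.self_of_nhds]
  simp

/-- The single term that survives the conditions on germs is the one in `h`. -/
theorem courantForm_eq_zero_of_ann {a b c : ∀ x : M, BigTangent m x} {x : M}
    (hb : ∀ᶠ y in nhds x, (b y).1 = 0) (hba : ∀ᶠ y in nhds x, (b y).2 (a y).1 = 0)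
    (hbc : ∀ᶠ y in nhds x, (b y).2 (c y).1 = 0)
    (h : (b x).2 (VectorField.mlieBracket (𝓡 m) (fun y => (a y).1) (fun y => (c y).1) x) = 0) :
    courantForm a b c x = 0 := by
  have h' : (fun y => (a y).2 (b y).1 - (b y).2 (a y).1) =ᶠ[nhds x] fun _ => 0 := by
    filter_upwards [hb, hba] with y h1 h2
    simp [h1, h2]
  rw [courantForm, dFun_eq_zero h', dFun_eq_zero hbc, mlieBracket_eq_zero_left hb,
    mlieBracket_eq_zero_right hb, hb.self_of_nhds, h]
  simp

variable [IsManifold (𝓡 m) ∞ M] {a a' b b' c c' : ∀ x : M, BigTangent m x}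

theorem SmoothOn.contMDiff_fst (ha : SmoothOn a univ) :
    ContMDiff (𝓡 m) ((𝓡 m).prod 𝓘(ℝ, EuclideanSpace ℝ (Fin m))) ∞
      (fun x => TotalSpace.mk' (EuclideanSpace ℝ (Fin m)) (E := TangentSpace (𝓡 m) (M := M))
        x (a x).1) := contMDiffOn_univ.1 ha.1

theorem SmoothOn.contMDiff_snd (ha : SmoothOn a univ) :
    ContMDiff (𝓡 m) ((𝓡 m).prod 𝓘(ℝ, EuclideanSpace ℝ (Fin m) →L[ℝ] ℝ)) ∞
      (fun x => TotalSpace.mk' (EuclideanSpace ℝ (Fin m) →L[ℝ] ℝ)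
        (E := fun x : M => TangentSpace (𝓡 m) x →L[ℝ] Trivial M ℝ x) x (a x).2) :=
  contMDiffOn_univ.1 ha.2

theorem SmoothOn.contMDiff_pairing (ha : SmoothOn a univ) (hb : SmoothOn b univ) :
    ContMDiff (𝓡 m) 𝓘(ℝ, ℝ) ∞ (fun x => (a x).2 (b x).1) :=
  contMDiffOn_univ.1 (ha.pairing hb)

theorem SmoothOn.mdifferentiableAt_pairing (ha : SmoothOn a univ) (hb : SmoothOn b univ) (x : M) :
    MDifferentiableAt (𝓡 m) 𝓘(ℝ, ℝ) (fun x => (a x).2 (b x).1) x :=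
  (ha.contMDiff_pairing hb x).mdifferentiableAt (by simp)

theorem SmoothOn.mdifferentiableAt_fst (ha : SmoothOn a univ) (x : M) :
    MDifferentiableAt (𝓡 m) ((𝓡 m).prod 𝓘(ℝ, EuclideanSpace ℝ (Fin m)))
      (fun x => TotalSpace.mk' (EuclideanSpace ℝ (Fin m)) (E := TangentSpace (𝓡 m) (M := M))
        x (a x).1) x :=
  (ha.contMDiff_fst x).mdifferentiableAt (by simp)

/-- `lieDerivForm_apply` eliminates both Lie derivatives, and the `2` absorbs the `1/2` in `metric`.
-/
theorem two_mul_metric_courant (ha : SmoothOn a univ) (hb : SmoothOn b univ)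
    (hc : SmoothOn c univ) (x : M) :
    2 * metric (TangentSpace (𝓡 m) x) (courant a b x) (c x) = courantForm a b c x := by
  have h1 := lieDerivForm_apply (X := fun y => (a y).1) (x := x) hc.contMDiff_fst hb.contMDiff_snd
  have h2 := lieDerivForm_apply (X := fun y => (b y).1) (x := x) hc.contMDiff_fst ha.contMDiff_snd
  rw [metric_apply, courant, courantForm, ← h1, ← h2]
  simp only [add_apply, sub_apply, smul_apply, smul_eq_mul]
  ring

theorem courantForm_add_left (ha : SmoothOn a univ) (ha' : SmoothOn a' univ)
    (hb : SmoothOn b univ) (hc : SmoothOn c univ) (x : M) :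
    courantForm (a + a') b c x = courantForm a b c x + courantForm a' b c x := by
  have h1 (Y : ∀ x : M, TangentSpace (𝓡 m) x) :
      VectorField.mlieBracket (𝓡 m) (fun y => ((a + a') y).1) Y x =
        VectorField.mlieBracket (𝓡 m) (fun y => (a y).1) Y x +
          VectorField.mlieBracket (𝓡 m) (fun y => (a' y).1) Y x :=
    VectorField.mlieBracket_add_left (ha.mdifferentiableAt_fst x) (ha'.mdifferentiableAt_fst x)
  have h2 : (fun y => ((a + a') y).2 (c y).1) =
      fun y => (a y).2 (c y).1 + (a' y).2 (c y).1 := rfl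
  have h3 : (fun y => ((a + a') y).2 (b y).1 - (b y).2 ((a + a') y).1) =
      fun y => ((a y).2 (b y).1 - (b y).2 (a y).1) + ((a' y).2 (b y).1 - (b y).2 (a' y).1) := by
    ext y
    simp only [Pi.add_apply, Prod.fst_add, Prod.snd_add, add_apply, map_add]
    ring
  have h4 {d : ∀ x : M, BigTangent m x} (hd : SmoothOn d univ) :
      MDifferentiableAt (𝓡 m) 𝓘(ℝ, ℝ) (fun y => (d y).2 (b y).1 - (b y).2 (d y).1) x :=
    (hd.mdifferentiableAt_pairing hb x).sub (hb.mdifferentiableAt_pairing hd x)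
  rw [courantForm, courantForm, courantForm, h1, h1, h2, h3,
    dFun_add (ha.mdifferentiableAt_pairing hc x) (ha'.mdifferentiableAt_pairing hc x),
    dFun_add (h4 ha) (h4 ha')]
  simp only [Pi.add_apply, Prod.fst_add, Prod.snd_add, add_apply, map_add]
  ring

theorem courantForm_add_middle (ha : SmoothOn a univ) (hb : SmoothOn b univ)
    (hb' : SmoothOn b' univ) (hc : SmoothOn c univ) (x : M) :
    courantForm a (b + b') c x = courantForm a b c x + courantForm a b' c x := by
  rw [courantForm_swap, courantForm_add_left hb hb' ha hc, courantForm_swap a b,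
    courantForm_swap a b']
  ring

theorem courantForm_add_right (ha : SmoothOn a univ) (hb : SmoothOn b univ)
    (hc : SmoothOn c univ) (hc' : SmoothOn c' univ) (x : M) :
    courantForm a b (c + c') x = courantForm a b c x + courantForm a b c' x := by
  have h1 (Y : ∀ x : M, TangentSpace (𝓡 m) x) :
      VectorField.mlieBracket (𝓡 m) Y (fun y => ((c + c') y).1) x =
        VectorField.mlieBracket (𝓡 m) Y (fun y => (c y).1) x +
          VectorField.mlieBracket (𝓡 m) Y (fun y => (c' y).1) x :=
    VectorField.mlieBracket_add_right (hc.mdifferentiableAt_fst x) (hc'.mdifferentiableAt_fst x)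
  have h2 (a : ∀ x : M, BigTangent m x) : (fun y => (a y).2 ((c + c') y).1) =
      fun y => (a y).2 (c y).1 + (a y).2 (c' y).1 := by
    ext y
    exact map_add _ _ _
  rw [courantForm, courantForm, courantForm, h1, h1, h2, h2,
    dFun_add (ha.mdifferentiableAt_pairing hc x) (ha.mdifferentiableAt_pairing hc' x),
    dFun_add (hb.mdifferentiableAt_pairing hc x) (hb.mdifferentiableAt_pairing hc' x)]
  simp only [Pi.add_apply, Prod.fst_add, Prod.snd_add, add_apply, map_add]
  ring

theorem continuous_dFun_apply {f : M → ℝ} (hf : ContMDiff (𝓡 m) 𝓘(ℝ, ℝ) ∞ f)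
    (ha : SmoothOn a univ) : Continuous fun x => dFun (m := m) f x (a x).1 := by
  have h := (hf.continuous_tangentMap (by simp)).comp ha.contMDiff_fst.continuous
  exact (contMDiff_snd_tangentBundle_modelSpace ℝ 𝓘(ℝ, ℝ) (n := 0)).continuous.comp h

theorem continuous_snd_mlieBracket (ha : SmoothOn a univ) (hb : SmoothOn b univ)
    (hc : SmoothOn c univ) :
    Continuous fun x =>
      (a x).2 (VectorField.mlieBracket (𝓡 m) (fun y => (b y).1) (fun y => (c y).1) x) := by
  have : IsManifold (𝓡 m) (minSmoothness ℝ 2) M := by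
    rw [minSmoothness_of_isRCLikeNormedField]
    infer_instance
  -- Smoothness of the bracket of fields of class `n` asks for a manifold of class `n + 1`; for `n =
  -- ∞` this is again `∞`.
  have : IsManifold (𝓡 m) (((⊤ : ℕ∞) : ℕ∞ω) + 1) M := ‹IsManifold (𝓡 m) ∞ M›
  have h : ContMDiff (𝓡 m) ((𝓡 m).prod 𝓘(ℝ, EuclideanSpace ℝ (Fin m))) (0 : ℕ∞)
      (fun x => TotalSpace.mk' (EuclideanSpace ℝ (Fin m)) (E := TangentSpace (𝓡 m) (M := M))
        x (VectorField.mlieBracket (𝓡 m) (fun y => (b y).1) (fun y => (c y).1) x)) :=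
    ContDiff.mlieBracket_vectorField (n := (⊤ : ℕ∞)) (m := (0 : ℕ∞))
      hb.contMDiff_fst hc.contMDiff_fst (by simp)
  have h' := (ha.contMDiff_snd.of_le (by simp)).clm_bundle_apply h
  have : ContMDiff (𝓡 m) 𝓘(ℝ, ℝ) (0 : ℕ∞) fun x =>
      (a x).2 (VectorField.mlieBracket (𝓡 m) (fun y => (b y).1) (fun y => (c y).1) x) :=
    fun x => (contMDiffAt_section _).1 (h' x)
  exact this.continuous

theorem continuous_courantForm (ha : SmoothOn a univ) (hb : SmoothOn b univ)
    (hc : SmoothOn c univ) : Continuous (courantForm a b c) :=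
  ((((continuous_dFun_apply (hb.contMDiff_pairing hc) ha).sub
    (continuous_snd_mlieBracket hb ha hc)).sub
    ((continuous_dFun_apply (ha.contMDiff_pairing hc) hb).sub
    (continuous_snd_mlieBracket ha hb hc))).add
    (continuous_const.mul (continuous_dFun_apply
      ((ha.contMDiff_pairing hb).sub (hb.contMDiff_pairing ha)) hc))).add
    (continuous_snd_mlieBracket hc ha hb)

end CourantForm

/-! ### Determinants, local frames and the rank of `pr E`. -/

section Frames

theorem exists_dual_family {W : Type*} [AddCommGroup W] [Module ℝ W] {r : ℕ} {v : Fin r → W}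
    (hv : LinearIndependent ℝ v) :
    ∃ l : Fin r → W →ₗ[ℝ] ℝ, (Matrix.of fun j i => l j (v i)) = 1 := by
  obtain ⟨g, hg⟩ := (Fintype.linearCombination ℝ v).exists_leftInverse_of_injective
    (LinearMap.ker_eq_bot.2
      (linearIndependent_iff_injective_fintypeLinearCombination.1 hv))
  refine ⟨fun j => LinearMap.proj j ∘ₗ g, ?_⟩
  ext j i
  have h := congrFun (DFunLike.congr_fun hg (Pi.single i 1)) j
  simpa [Matrix.one_apply, Pi.single_apply, Fintype.linearCombination_apply_single] using h

theorem linearIndependent_of_det_ne_zero {W : Type*} [AddCommGroup W] [Module ℝ W] {r : ℕ}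
    {v : Fin r → W} {l : Fin r → W →ₗ[ℝ] ℝ} (h : (Matrix.of fun j i => l j (v i)).det ≠ 0) :
    LinearIndependent ℝ v := by
  rw [Fintype.linearIndependent_iff]
  intro c hc
  refine congrFun (Matrix.eq_zero_of_mulVec_eq_zero h (v := c) ?_)
  ext j
  have := congrArg (l j) hc
  simpa [Matrix.mulVec, dotProduct, mul_comm] using this

/-- Cramer's rule yields coefficients that are polynomial in the data up to division by the
determinant, hence smooth in `x`. -/
theorem cramer_mulVec_eq {r : ℕ} (A : Matrix (Fin r) (Fin r) ℝ) (c : Fin r → ℝ) :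
    A.cramer (A.mulVec c) = A.det • c := by
  rw [Matrix.cramer_eq_adjugate_mulVec, Matrix.mulVec_mulVec, Matrix.adjugate_mul,
    Matrix.smul_mulVec, Matrix.one_mulVec]

theorem exists_submodule_dual_basis {W : Type*} [AddCommGroup W] [Module ℝ W]
    [FiniteDimensional ℝ W] {r : ℕ} {P : Submodule ℝ W} (hP : Module.finrank ℝ P = r) :
    ∃ (v : Fin r → W) (l : Fin r → W →ₗ[ℝ] ℝ), (∀ i, v i ∈ P) ∧
      (Matrix.of fun j i => l j (v i)) = 1 := by
  let B := Module.finBasisOfFinrankEq ℝ P hP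
  have hB : LinearIndependent ℝ fun i => (B i : W) :=
    B.linearIndependent.map' P.subtype (Submodule.ker_subtype _)
  obtain ⟨l, hl⟩ := exists_dual_family hB
  exact ⟨fun i => B i, l, fun i => (B i).2, hl⟩

/-- Functionals are represented through `g` so that they extend to smooth sections around the point.
-/
theorem exists_metric_dual_basis {V : Type*} [AddCommGroup V] [Module ℝ V] [TopologicalSpace V]
    [IsTopologicalAddGroup V] [ContinuousSMul ℝ V] [T2Space V] [FiniteDimensional ℝ V] {k : ℕ}
    {P : Submodule ℝ (Big V)} (hP : Module.finrank ℝ P = k) :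
    ∃ v w : Fin k → Big V, (∀ i, v i ∈ P) ∧ (Matrix.of fun j i => metric V (w j) (v i)) = 1 := by
  obtain ⟨v, l, hv, hl⟩ := exists_submodule_dual_basis (W := Big V) hP
  refine ⟨v, fun j => (LinearMap.BilinForm.toDual (metric V)
    (metric_nondegenerate V)).symm (l j), hv, ?_⟩
  rw [← hl]
  ext j i
  exact LinearMap.BilinForm.apply_toDual_symm_apply (B := metric V)
    (hB := metric_nondegenerate V) (l j) (v i)

theorem span_range_eq_of_finrank_eq {W : Type*} [AddCommGroup W] [Module ℝ W]
    [FiniteDimensional ℝ W] {r : ℕ} {v : Fin r → W} (hv : LinearIndependent ℝ v)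
    {P : Submodule ℝ W} (hP : Module.finrank ℝ P = r) (h : ∀ i, v i ∈ P) :
    Submodule.span ℝ (range v) = P := by
  have hle : Submodule.span ℝ (range v) ≤ P := by
    rw [Submodule.span_le]
    rintro _ ⟨i, rfl⟩
    exact h i
  exact Submodule.eq_of_le_of_finrank_le hle (by
    rw [finrank_span_eq_card hv, hP, Fintype.card_fin])

variable {m : ℕ} {M : Type*} [TopologicalSpace M] [ChartedSpace (EuclideanSpace ℝ (Fin m)) M]

theorem contMDiffOn_det {r : ℕ} {A : M → Matrix (Fin r) (Fin r) ℝ} {U : Set M}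
    (hA : ∀ i j, ContMDiffOn (𝓡 m) 𝓘(ℝ, ℝ) ∞ (fun x => A x i j) U) :
    ContMDiffOn (𝓡 m) 𝓘(ℝ, ℝ) ∞ (fun x => (A x).det) U := by
  simp only [Matrix.det_apply']
  exact contMDiffOn_finsetSum fun σ _ => contMDiffOn_const.mul
    (contMDiffOn_finsetProd fun i _ => hA _ _)


theorem linearIndependent_fst_of_det_ne_zero {r : ℕ} {e t : Fin r → ∀ x : M, BigTangent m x} {x : M}
    (h : (Matrix.of fun j i => (t j x).2 (e i x).1).det ≠ 0) :
    LinearIndependent ℝ fun i => (e i x).1 :=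
  linearIndependent_of_det_ne_zero (l := fun j => ((t j x).2 : _ →ₗ[ℝ] ℝ)) h

variable [IsManifold (𝓡 m) ∞ M]

theorem isOpen_det_ne_zero {r : ℕ} {e t : Fin r → ∀ x : M, BigTangent m x}
    (he : ∀ i, SmoothOn (e i) univ) (ht : ∀ j, SmoothOn (t j) univ) :
    IsOpen {x | (Matrix.of fun j i => (t j x).2 (e i x).1).det ≠ 0} :=
  isOpen_ne_fun (contMDiffOn_univ.1
    (contMDiffOn_det fun j i => (ht j).pairing (he i))).continuous continuous_const

variable [T2Space M]

/-- A differentiable field of subspaces of constant dimension is a subbundle. -/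
theorem IsDifferentiable.isSubbundle {k : ℕ} {D : ∀ x : M, Submodule ℝ (BigTangent m x)}
    (hD : IsDifferentiable D) (hk : ∀ x, Module.finrank ℝ (D x) = k) : IsSubbundle k D := by
  intro x₀
  obtain ⟨v, w, hv, hvw⟩ := exists_metric_dual_basis (hk x₀)
  choose s hs hsv using fun i => hD.exists_section (hv i)
  choose t ht htw using fun j => exists_smooth_section (w j)
  -- This matrix is the identity at `x₀`, so the sections stay independent wherever its determinant
  -- is nonzero; being `k` in number, they then span `D x`.
  let A : M → Matrix (Fin k) (Fin k) ℝ := fun x =>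
    Matrix.of fun j i => metric (TangentSpace (𝓡 m) x) (t j x) (s i x)
  have hA : ContMDiffOn (𝓡 m) 𝓘(ℝ, ℝ) ∞ (fun x => (A x).det) univ :=
    contMDiffOn_det fun j i => (ht j).metric (hs i).1
  have hA₀ : A x₀ = 1 := by simp only [A, hsv, htw, hvw]
  refine ⟨{x | (A x).det ≠ 0}, ?_, by simp [hA₀], s, fun i => (hs i).1.mono (subset_univ _),
    fun x hx => ?_⟩
  · exact isOpen_ne_fun (contMDiffOn_univ.1 hA).continuous continuous_const
  · have hli : LinearIndependent ℝ fun i => s i x :=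
      linearIndependent_of_det_ne_zero (l := fun j => metric _ (t j x)) hx
    exact ⟨hli, span_range_eq_of_finrank_eq hli (hk x) fun i => (hs i).2 x⟩

/-- Sections of `E` whose vector parts are a basis of the projection of `E` at `x₀`, together with
sections whose covector parts test their linear independence. -/
theorem IsDifferentiable.exists_pr_frame {E : ∀ x : M, Submodule ℝ (BigTangent m x)}
    (hE : IsDifferentiable E) (x₀ : M) :
    ∃ e t : Fin (Module.finrank ℝ (pr (E x₀))) → ∀ x : M, BigTangent m x,
      (∀ i, e i ∈ sections E) ∧ (∀ j, SmoothOn (t j) univ) ∧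
      (Matrix.of fun j i => (t j x₀).2 (e i x₀).1).det ≠ 0 := by
  obtain ⟨v, l, hv, hl⟩ := exists_submodule_dual_basis (P := pr (E x₀)) rfl
  choose α hα using fun i => mem_pr.1 (hv i)
  choose e he heB using fun i => hE.exists_section (hα i)
  choose t ht htl using fun j => exists_smooth_section
    ((0, LinearMap.toContinuousLinearMap (l j)) : BigTangent m x₀)
  refine ⟨e, t, he, ht, ?_⟩
  have h : (Matrix.of fun j i => (t j x₀).2 (e i x₀).1) = 1 := by
    rw [← hl]
    ext j i
    simp [heB, htl]
  simp [h]

/-- Lower semicontinuity of rank: sections with independent vector parts at `x₀` keep them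
independent nearby. -/
theorem IsDifferentiable.eventually_finrank_pr_le {E : ∀ x : M, Submodule ℝ (BigTangent m x)}
    (hE : IsDifferentiable E) (x₀ : M) :
    ∀ᶠ x in nhds x₀, Module.finrank ℝ (pr (E x₀)) ≤ Module.finrank ℝ (pr (E x)) := by
  obtain ⟨e, t, he, ht, h₀⟩ := hE.exists_pr_frame x₀
  filter_upwards [(isOpen_det_ne_zero (fun i => (he i).1) ht).mem_nhds h₀] with x hx
  have hli := linearIndependent_fst_of_det_ne_zero hx
  calc _ = Module.finrank ℝ (Submodule.span ℝ (range fun i => (e i x).1)) := by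
        rw [finrank_span_eq_card hli, Fintype.card_fin]
    _ ≤ _ := Submodule.finrank_mono (Submodule.span_le.2 (by
        rintro _ ⟨i, rfl⟩
        exact fst_mem_pr ((he i).2 x)))

/-- The points near which the projection of `E` does not gain dimension are dense. -/
theorem IsDifferentiable.dense_regular {E : ∀ x : M, Submodule ℝ (BigTangent m x)}
    (hE : IsDifferentiable E) :
    Dense {x₀ : M | ∀ᶠ x in nhds x₀,
      Module.finrank ℝ (pr (E x)) = Module.finrank ℝ (pr (E x₀))} := by
  rw [dense_iff_inter_open]
  intro U hU hne
  let S := (fun x => Module.finrank ℝ (pr (E x))) '' U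
  have hS : BddAbove S := by
    refine ⟨m, ?_⟩
    rintro _ ⟨x, -, rfl⟩
    exact (Submodule.finrank_le _).trans (finrank_tangentSpace x).le
  -- The rank is an integer bounded by `m`, so it attains a maximum on `U`; by lower semicontinuity
  -- it cannot drop near such a point either.
  obtain ⟨x₀, hx₀, h⟩ := Nat.sSup_mem (hne.image _) hS
  refine ⟨x₀, hx₀, ?_⟩
  filter_upwards [hE.eventually_finrank_pr_le x₀, hU.mem_nhds hx₀] with x hx hxU
  exact le_antisymm ((le_csSup hS (mem_image_of_mem _ hxU)).trans h.ge) hx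

/-- Near a point where the dimension of the projection of `E` is locally constant, every field
tangent to this projection is the vector part of a section of `E`. -/
theorem IsDifferentiable.exists_section_fst_eq {E : ∀ x : M, Submodule ℝ (BigTangent m x)}
    (hE : IsDifferentiable E) {x₀ : M}
    (hreg : ∀ᶠ x in nhds x₀, Module.finrank ℝ (pr (E x)) = Module.finrank ℝ (pr (E x₀)))
    {a : ∀ x : M, BigTangent m x} (ha : SmoothOn a univ) (haE : ∀ x, (a x).1 ∈ pr (E x)) :
    ∃ s ∈ sections E, ∀ᶠ x in nhds x₀, (s x).1 = (a x).1 := by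
  obtain ⟨e, t, he, ht, h₀⟩ := hE.exists_pr_frame x₀
  let A : M → Matrix _ _ ℝ := fun x => Matrix.of fun j i => (t j x).2 (e i x).1
  let v : M → _ → ℝ := fun x j => (t j x).2 (a x).1
  let U := {x | (A x).det ≠ 0}
  have hU : IsOpen U := isOpen_det_ne_zero (fun i => (he i).1) ht
  have hA (j i) : ContMDiffOn (𝓡 m) 𝓘(ℝ, ℝ) ∞ (fun x => A x j i) U :=
    ((ht j).pairing (he i).1).mono (subset_univ _)
  -- The expected coefficients of `(a x).1` in the frame `(e i x).1`, found by solving the linear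
  -- system of pairings with `t j`.
  have hcoef (i) : ContMDiffOn (𝓡 m) 𝓘(ℝ, ℝ) ∞
      (fun x => ((A x).det)⁻¹ * (A x).cramer (v x) i) U := by
    refine ContMDiffOn.mul ((contMDiffOn_det hA).inv₀ fun x hx => hx) ?_
    simp only [Matrix.cramer_apply]
    refine contMDiffOn_det fun j i' => ?_
    simp only [Matrix.updateCol_apply]
    split_ifs
    · exact ((ht j).pairing ha).mono (subset_univ _)
    · exact hA j i'
  have hs : SmoothOn (fun x => ∑ i, (((A x).det)⁻¹ * (A x).cramer (v x) i) • e i x) U :=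
    .sum fun i _ => .smul (hcoef i) ((he i).1.mono (subset_univ _))
  obtain ⟨f, hf1, -, hf⟩ := hs.exists_global hU h₀
  refine ⟨_, ⟨hf, fun x => Submodule.smul_mem _ _ (Submodule.sum_mem _ fun i _ =>
    Submodule.smul_mem _ _ ((he i).2 x))⟩, ?_⟩
  filter_upwards [hf1, hreg, hU.mem_nhds h₀] with x hfx hr hx
  have hli := linearIndependent_fst_of_det_ne_zero hx
  -- Local constancy of the rank enters here: without it the frame at `x₀` could fail to span `pr (E
  -- x)` nearby.
  have hspan : Submodule.span ℝ (range fun i => (e i x).1) = pr (E x) :=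
    span_range_eq_of_finrank_eq hli hr fun i => fst_mem_pr ((he i).2 x)
  have hax := haE x
  rw [← hspan, Submodule.mem_span_range_iff_exists_fun] at hax
  obtain ⟨c, hc⟩ := hax
  have hv : v x = (A x).mulVec c := by
    ext j
    simp only [v, A, ← hc, Matrix.mulVec, dotProduct, Matrix.of_apply, map_sum, map_smul,
      smul_eq_mul]
    exact Finset.sum_congr rfl fun i _ => mul_comm _ _
  have hx' : (A x).det ≠ 0 := hx
  simp only [hfx, one_smul, Prod.fst_sum, Prod.smul_fst, hv, cramer_mulVec_eq, Pi.smul_apply,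
    smul_eq_mul, inv_mul_cancel_left₀ hx', hc]

end Frames

/-! ### Integrability of `D(E)`. -/

section Integrability

variable {m : ℕ} {M : Type*} [TopologicalSpace M] [ChartedSpace (EuclideanSpace ℝ (Fin m)) M]
  [IsManifold (𝓡 m) ∞ M] [T2Space M] {E : ∀ x : M, Submodule ℝ (BigTangent m x)}

omit [T2Space M] in
theorem sections_le_diracExt {a : ∀ x : M, BigTangent m x} (ha : a ∈ sections E) :
    a ∈ sections fun x => diracExt (E x) :=
  ⟨ha.1, fun x => Submodule.mem_sup_left (ha.2 x)⟩

omit [T2Space M] in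
theorem sections_sub {a b : ∀ x : M, BigTangent m x} (ha : a ∈ sections E) (hb : b ∈ sections E) :
    a - b ∈ sections E :=
  ⟨ha.1.sub hb.1, fun x => (E x).sub_mem (ha.2 x) (hb.2 x)⟩

/-- A section of `D(E)` without vector part annihilates the vector parts of sections of `E`. -/
theorem IsIsotropic.diracExt_apply_eq_zero {V : Type*} [AddCommGroup V] [Module ℝ V]
    [TopologicalSpace V] {P : Submodule ℝ (Big V)} (hP : IsIsotropic P) {a b : Big V}
    (ha : a ∈ BigIso.diracExt P) (ha₀ : a.1 = 0) (hb : b ∈ P) : a.2 b.1 = 0 := by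
  have := hP.diracExt.add_eq_zero ha (Submodule.mem_sup_left hb)
  simpa [ha₀] using this

omit [T2Space M] in
-- The mixed case. The bracket of the vector parts of `e` and `e'` is the vector part of `courant e
-- e'`, which lies in `E`, so `b` annihilates it.
theorem courantForm_eq_zero_of_section_of_ann (hE : ∀ x, IsIsotropic (E x)) (hint : IsIntegrable E)
    {x : M} {e e' b c : ∀ x : M, BigTangent m x} (he : e ∈ sections E) (he' : e' ∈ sections E)
    (hb : b ∈ sections fun x => diracExt (E x)) (hb₀ : ∀ᶠ y in nhds x, (b y).1 = 0)
    (hc : SmoothOn c univ) (hc₀ : ∀ᶠ y in nhds x, (c y).1 = 0) :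
    courantForm e b (e' + c) x = 0 := by
  rw [courantForm_add_right he.1 hb.1 he'.1 hc, courantForm_eq_zero_of_fst_snd e hb₀ hc₀, add_zero]
  have h {s : ∀ x : M, BigTangent m x} (hs : s ∈ sections E) :
      ∀ᶠ y in nhds x, (b y).2 (s y).1 = 0 := by
    filter_upwards [hb₀] with y hy
    exact (hE y).diracExt_apply_eq_zero (hb.2 y) hy (hs.2 y)
  refine courantForm_eq_zero_of_ann hb₀ (h he) (h he') ?_
  exact (hE x).diracExt_apply_eq_zero (hb.2 x) hb₀.self_of_nhds (hint e he e' he' x)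

theorem courantForm_eq_zero_of_regular (hE : ∀ x, IsIsotropic (E x)) (hEd : IsDifferentiable E)
    (hint : IsIntegrable E) {x : M}
    (hreg : ∀ᶠ y in nhds x, Module.finrank ℝ (pr (E y)) = Module.finrank ℝ (pr (E x)))
    {a b c : ∀ x : M, BigTangent m x} (ha : a ∈ sections fun x => diracExt (E x))
    (hb : b ∈ sections fun x => diracExt (E x)) (hc : c ∈ sections fun x => diracExt (E x)) :
    courantForm a b c x = 0 := by
  -- Since `pr D(E) = pr E`, the vector part of `a` lifts near `x` to a section of `E`; the
  -- difference remains in `D(E)` and has no vector part there.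
  have dec {a : ∀ x : M, BigTangent m x} (ha : a ∈ sections fun x => diracExt (E x)) :
      ∃ e g : ∀ x : M, BigTangent m x, e ∈ sections E ∧ g ∈ sections (fun x => diracExt (E x)) ∧
        (∀ᶠ y in nhds x, (g y).1 = 0) ∧ a = e + g := by
    obtain ⟨e, he, h⟩ := hEd.exists_section_fst_eq hreg ha.1 fun y => by
      rw [← pr_diracExt]
      exact fst_mem_pr (ha.2 y)
    refine ⟨e, a - e, he, sections_sub ha (sections_le_diracExt he), ?_, by abel⟩
    filter_upwards [h] with y hy
    simp [hy]
  have hc' := hc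
  obtain ⟨ea, ga, hea, hga, hga₀, rfl⟩ := dec ha
  obtain ⟨eb, gb, heb, hgb, hgb₀, rfl⟩ := dec hb
  obtain ⟨ec, gc, hec, hgc, hgc₀, rfl⟩ := dec hc
  have h1 : courantForm ea eb (ec + gc) x = 0 := by
    rw [← two_mul_metric_courant hea.1 heb.1 hc'.1,
      (hE x).diracExt _ (Submodule.mem_sup_left (hint ea hea eb heb x)) _ (hc'.2 x), mul_zero]
  have h2 : courantForm ea gb (ec + gc) x = 0 :=
    courantForm_eq_zero_of_section_of_ann hE hint hea hec hgb hgb₀ hgc.1 hgc₀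
  have h3 : courantForm ga eb (ec + gc) x = 0 := by
    rw [courantForm_swap,
      courantForm_eq_zero_of_section_of_ann hE hint heb hec hga hga₀ hgc.1 hgc₀, neg_zero]
  have h4 : courantForm ga gb (ec + gc) x = 0 := courantForm_eq_zero_of_fst_fst hga₀ hgb₀ _
  rw [courantForm_add_left hea.1 hga.1 hb.1 hc'.1, courantForm_add_middle hea.1 heb.1 hgb.1 hc'.1,
    courantForm_add_middle hga.1 heb.1 hgb.1 hc'.1, h1, h2, h3, h4]
  simp

/-- Differentiability of `D(E)` puts a global section through each test vector `v`, so that the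
pairing at `x` becomes the value of a continuous function vanishing on a dense set. -/
theorem IsIntegrable.diracExt (hE : ∀ x, IsIsotropic (E x)) (hEd : IsDifferentiable E)
    (hD : IsDifferentiable fun x => BigIso.diracExt (E x)) (hint : IsIntegrable E) :
    IsIntegrable fun x => BigIso.diracExt (E x) := by
  intro a ha b hb x
  refine orth_diracExt_le (hE x) fun v hv => ?_
  obtain ⟨c, hc, rfl⟩ := hD.exists_section hv
  have h : courantForm a b c = fun _ => 0 :=
    (continuous_courantForm ha.1 hb.1 hc.1).ext_on hEd.dense_regular continuous_const
      fun y hy => courantForm_eq_zero_of_regular hE hEd hint hy ha hb hc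
  have h' := two_mul_metric_courant ha.1 hb.1 hc.1 x
  rw [h, metric_comm] at h'
  simpa using h'

end Integrability

end BigIso

end

theorem corollary2p1 {m : ℕ} {M : Type*} [TopologicalSpace M] [T2Space M]
    [ChartedSpace (EuclideanSpace ℝ (Fin m)) M] [IsManifold (𝓡 m) ∞ M] :
    (∀ (x : M) (P : Submodule ℝ (BigIso.BigTangent m x)), BigIso.IsIsotropic P →
      P ≤ BigIso.diracExt P ∧
      BigIso.diracExt P ≤ BigIso.orth P ∧
      Maximal BigIso.IsIsotropic (BigIso.diracExt P) ∧
      Module.finrank ℝ (BigIso.diracExt P) = m ∧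
      ∀ (X : TangentSpace (𝓡 m) x) (α : TangentSpace (𝓡 m) x →L[ℝ] ℝ),
        (X, α) ∈ BigIso.diracExt P ↔
          ∃ hX : X ∈ BigIso.pr P, ∀ (Y : TangentSpace (𝓡 m) x)
            (hY : Y ∈ BigIso.pr (BigIso.orth P)), Y ∈ BigIso.pr P →
              α Y = BigIso.varpi P ⟨X, hX⟩ ⟨Y, hY⟩) ∧
    ∀ (k : ℕ) (E : ∀ x : M, Submodule ℝ (BigIso.BigTangent m x)), BigIso.IsBigIsotropic k E →
      BigIso.IsDifferentiable (fun x => BigIso.diracExt (E x)) →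
        BigIso.IsAlmostDirac (fun x => BigIso.diracExt (E x)) ∧
        (BigIso.IsIntegrable E → BigIso.IsDirac (fun x => BigIso.diracExt (E x)))
 := by
  refine ⟨fun x P hP => ⟨le_sup_left, hP.diracExt.le_orth.trans ?_, BigIso.maximal_diracExt hP,
    (BigIso.finrank_diracExt hP).trans (BigIso.finrank_tangentSpace x),
    fun X α => hP.mem_diracExt_iff⟩, fun k E hE hD => ?_⟩
  -- Taking orthogonals reverses `P ≤ D`, so `D ≤ D^⊥ ≤ P^⊥`.
  · exact LinearMap.BilinForm.orthogonal_le le_sup_left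
  · have hDirac : BigIso.IsAlmostDirac (fun x => BigIso.diracExt (E x)) :=
      ⟨hD.isSubbundle fun x => (BigIso.finrank_diracExt (hE.isotropic x)).trans
        (BigIso.finrank_tangentSpace x), fun x => BigIso.maximal_diracExt (hE.isotropic x)⟩
    exact ⟨hDirac, fun hint => ⟨hDirac,
      hint.diracExt hE.isotropic hE.subbundle.isDifferentiable hD⟩⟩
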